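/- All Hilbert spaces are complex, $\mathbf B(\mathcal H,\mathcal K)$ denotes the bounded linear operators from $\mathcal H$ to $\mathcal K$, $\mathbf B(\mathcal H)=\mathbf B(\mathcal H,\mathcal H)$, a representation of a unital $C^*$-algebra $\mathscr A$ is a unital $*$-homomorphism $\mathscr A\to\mathbf B(\mathcal H)$, and a character is a unital $*$-homomorphism $\mathscr A\to\mathbb C$. A finite or countably infinite set $G$ of generators of the unital $C^*$-algebra $\mathscr A$ is hyperrigid if for every faithful representation $\sigma\colon\mathscr A\to\mathbf B(\mathcal L)$ on a separable Hilbert space $\mathcal L$ and every sequence of unital completely positive maps $\Phi_k\colon\mathbf B(\mathcal L)\to\mathbf B(\mathcal L)$, the condition $\lim_k\|\Phi_k(\sigma(g))-\sigma(g)\|=0$ for all $g\in G$ implies $\lim_k\|\Phi_k(\sigma(a))-\sigma(a)\|=0$ for all $a\in\mathscr A$. A closed subspace $\mathcal M$ reduces a representation $\pi$ if $\mathcal M$ and $\mathcal M^\perp$ are invariant under all $\pi(a)$. The symbol $\bigvee$ stands for the closed linear span, $\oplus$ for an orthogonal sum of closed subspaces, and $\mathcal N$ and $\mathcal R$ for kernel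 and range. An operator $T$ is a pure contraction if $\|Th\|<\|h\|$ for all $h\ne0$. The defect space of an isometry $V$ is $\mathcal D(V)=\mathcal R(V)^\perp=\mathcal N(V^*)$, the orthogonal complement being taken in the space into which $V$ maps. Let $G$ be a hyperrigid subset of a unital $C^*$-algebra $\mathscr A$ and let $\chi$ be a character of $\mathscr A$ with $G\subseteq\ker\chi$. Let $\pi\colon\mathscr A\to\mathbf B(\mathcal H)$ and $\rho\colon\mathscr A\to\mathbf B(\mathcal K)$ be representations on separable Hilbert spaces and let $R\in\mathbf B(\mathcal H,\mathcal K)$ be a contraction (that is, $\|R\|\le1$) such that $\pi(g)=R^*\rho(g)R$ for every $g\in G$, and $\mathcal K=\bigvee_{a\in\mathscr A}\rho(a)R(\mathcal H)$. Put $$\triangle_R=I-R^*R,\qquad \mathcal M_\chi(\pi)=\bigcap_{a\in\mathscr A}\mathcal N(\pi(a)-\chi(a)I),\qquad \mathcal L_\chi=\bigvee_{a\in\mathscr A}\rho(a)R(\mathcal M_\chi(\pi)).$$ Then: (i) $\mathcal H=\mathcal H_I\oplus\mathcal H_{PC}$ and $\mathcal H_I=\mathcal H_U\oplus\mathcal H_S$,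 where $\mathcal H_I=\mathcal N(\triangle_R)$, $\mathcal H_U=\mathcal M_\chi(\pi)^\perp$, $\mathcal H_S=\mathcal N(\triangle_R)\cap\mathcal M_\chi(\pi)$ and $\mathcal H_{PC}=\overline{\mathcal R(\triangle_R)}$; (ii) $\mathcal K=\mathcal K_I\oplus\mathcal K_{PC}$ and $\mathcal K_I=\mathcal K_U\oplus\mathcal K_S$, where $\mathcal K_I=\overline{\mathcal R(R\triangle_R)}^{\,\perp}$, $\mathcal K_U=\mathcal L_\chi^\perp$, $\mathcal K_S=\overline{\mathcal R(R\triangle_R)}^{\,\perp}\cap\mathcal L_\chi$ and $\mathcal K_{PC}=\overline{\mathcal R(R\triangle_R)}$; (iii) $\mathcal H_U$, $\mathcal H_S$ and $\mathcal H_{PC}$ reduce $\pi$, and $\pi(a)|_{\mathcal H_U^\perp}=\chi(a)I_{\mathcal H_U^\perp}$ for every $a\in\mathscr A$; (iv) $\mathcal K_U$, $\mathcal K_S$ and $\mathcal K_{PC}$ reduce $\rho$, and $\rho(a)|_{\mathcal K_U^\perp}=\chi(a)I_{\mathcal K_U^\perp}$ for every $a\in\mathscr A$; (v) $R=R_I\oplus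 R_{PC}$ and $R_I=R_U\oplus R_S$ for some $R_I\in\mathbf B(\mathcal H_I,\mathcal K_I)$, $R_{PC}\in\mathbf B(\mathcal H_{PC},\mathcal K_{PC})$, $R_U\in\mathbf B(\mathcal H_U,\mathcal K_U)$ and $R_S\in\mathbf B(\mathcal H_S,\mathcal K_S)$ (which are thus restrictions of $R$); (vi) $R_U$ is unitary, $R_S$ is an isometry (hence so is $R_I$), and $R_{PC}$ is a pure contraction; (vii) $\pi(a)|_{\mathcal H_U}=R_U^*\,\rho(a)|_{\mathcal K_U}R_U$ for every $a\in\mathscr A$; (viii) $\mathcal D(R_I)=\mathcal D(R_S)=\mathcal N(R^*)$, as subspaces of $\mathcal K$. -/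

import Mathlib

open Filter Topology
open scoped CStarAlgebra

namespace RDilation

/-- `G` is a finite or countably infinite set of generators of the unital C⋆-algebra `A` (the
closed unital star subalgebra generated by `G` is `A`), and `G` is hyperrigid: for every faithful
representation `π` of `A` on a separable Hilbert space `L` and every sequence `Φ` of unital
completely positive maps of `B(L)` into itself, if `‖Φₖ(π(g)) - π(g)‖ → 0` for all `g ∈ G`, then
`‖Φₖ(π(a)) - π(a)‖ → 0` for all `a ∈ A`.
Every separable Hilbert space is unitarily equivalent to one whose underlying type lies in `Type`
(namely `ℓ²` of a countable index set), so quantifying over `L : Type` covers all separable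
Hilbert spaces. -/
structure IsHyperrigid {A : Type*} [CStarAlgebra A] (G : Set A) : Prop where
  countable : G.Countable
  generates : (StarAlgebra.adjoin ℂ G).topologicalClosure = ⊤
  rigid : ∀ (L : Type) [NormedAddCommGroup L] [InnerProductSpace ℂ L] [CompleteSpace L]
    [TopologicalSpace.SeparableSpace L] (π : A →⋆ₐ[ℂ] (L →L[ℂ] L)),
    Function.Injective π →
    ∀ Φ : ℕ → ((L →L[ℂ] L) →CP (L →L[ℂ] L)), (∀ k, Φ k 1 = 1) →
    (∀ g ∈ G, Tendsto (fun k => ‖Φ k (π g) - π g‖) atTop (𝓝 0)) →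
    ∀ a : A, Tendsto (fun k => ‖Φ k (π a) - π a‖) atTop (𝓝 0)

section Spaces

variable {E F : Type*} [NormedAddCommGroup E] [InnerProductSpace ℂ E]
  [NormedAddCommGroup F] [InnerProductSpace ℂ F]

/-- `U = V ⊕ W`, the orthogonal sum of the closed subspaces `V` and `W`. -/
structure IsOrthogonalSum (U V W : Submodule ℂ E) : Prop where
  isClosed_left : IsClosed (V : Set E)
  isClosed_right : IsClosed (W : Set E)
  isOrtho : V ⟂ W
  sup_eq : V ⊔ W = U

/-- `T` is a pure contraction: `‖T h‖ < ‖h‖` for all `h ≠ 0`. -/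
def IsPureContraction (T : E →L[ℂ] F) : Prop :=
  ∀ h : E, h ≠ 0 → ‖T h‖ < ‖h‖

/-- `T` is a unitary operator from `E` onto `F`: `T* T = I` and `T T* = I`. -/
def IsUnitaryOperator [CompleteSpace E] [CompleteSpace F] (T : E →L[ℂ] F) : Prop :=
  ContinuousLinearMap.adjoint T ∘L T = ContinuousLinearMap.id ℂ E ∧
    T ∘L ContinuousLinearMap.adjoint T = ContinuousLinearMap.id ℂ F

/-- The defect space `ran(V)ᗮ` of an isometry `V`. -/
noncomputable def defectSpace (V : E →L[ℂ] F) : Submodule ℂ F :=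
  (LinearMap.range (V : E →ₗ[ℂ] F))ᗮ

end Spaces

section Operators

variable {H K : Type*} [NormedAddCommGroup H] [InnerProductSpace ℂ H] [CompleteSpace H]
  [NormedAddCommGroup K] [InnerProductSpace ℂ K] [CompleteSpace K]

/-- The operator `Δ_R = I - R* R`. -/
noncomputable def defectOp (R : H →L[ℂ] K) : H →L[ℂ] H :=
  ContinuousLinearMap.id ℂ H - ContinuousLinearMap.adjoint R ∘L R

/-- `H_I = ker Δ_R`. -/
noncomputable abbrev spaceHI (R : H →L[ℂ] K) : Submodule ℂ H :=
  LinearMap.ker (defectOp R : H →ₗ[ℂ] H)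

/-- `H_PC`, the closure of `ran Δ_R`. -/
noncomputable abbrev spaceHPC (R : H →L[ℂ] K) : Submodule ℂ H :=
  (LinearMap.range (defectOp R : H →ₗ[ℂ] H)).topologicalClosure

/-- `K_PC`, the closure of `ran (R Δ_R)`. -/
noncomputable abbrev spaceKPC (R : H →L[ℂ] K) : Submodule ℂ K :=
  (LinearMap.range (R ∘L defectOp R : H →ₗ[ℂ] K)).topologicalClosure

/-- `K_I`, the orthogonal complement of the closure of `ran (R Δ_R)`. -/
noncomputable abbrev spaceKI (R : H →L[ℂ] K) : Submodule ℂ K :=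
  (spaceKPC R)ᗮ

end Operators

section Representations

variable {A : Type*} [CStarAlgebra A]
  {H K : Type*} [NormedAddCommGroup H] [InnerProductSpace ℂ H] [CompleteSpace H]
  [NormedAddCommGroup K] [InnerProductSpace ℂ K] [CompleteSpace K]

/-- The closed subspace `M` reduces the representation `π`: both `M` and `Mᗮ` are invariant under
every `π(a)`. -/
structure Reduces (π : A →⋆ₐ[ℂ] (H →L[ℂ] H)) (M : Submodule ℂ H) : Prop where
  isClosed : IsClosed (M : Set H)
  map_mem : ∀ a : A, ∀ x ∈ M, π a x ∈ M
  map_mem_orthogonal : ∀ a : A, ∀ x ∈ Mᗮ, π a x ∈ Mᗮ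

/-- `M_χ(π) = ⋂ₐ ker (π(a) - χ(a) I)`. -/
noncomputable def jointEigenspace (π : A →⋆ₐ[ℂ] (H →L[ℂ] H)) (χ : A →⋆ₐ[ℂ] ℂ) :
    Submodule ℂ H :=
  ⨅ a : A, LinearMap.ker (π a - χ a • ContinuousLinearMap.id ℂ H : H →ₗ[ℂ] H)

/-- `⋁ₐ ρ(a) R(M)`, the closed linear span of the subspaces `ρ(a) R(M)`, `a ∈ A`. -/
noncomputable def cyclicSpan (ρ : A →⋆ₐ[ℂ] (K →L[ℂ] K)) (R : H →L[ℂ] K) (M : Submodule ℂ H) :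
    Submodule ℂ K :=
  (⨆ a : A, M.map (ρ a ∘L R : H →ₗ[ℂ] K)).topologicalClosure

/-- `L_χ = ⋁ₐ ρ(a) R(M_χ(π))`. -/
noncomputable abbrev spaceL (π : A →⋆ₐ[ℂ] (H →L[ℂ] H)) (ρ : A →⋆ₐ[ℂ] (K →L[ℂ] K))
    (R : H →L[ℂ] K) (χ : A →⋆ₐ[ℂ] ℂ) : Submodule ℂ K :=
  cyclicSpan ρ R (jointEigenspace π χ)

/-- `H_U = M_χ(π)ᗮ`. -/
noncomputable abbrev spaceHU (π : A →⋆ₐ[ℂ] (H →L[ℂ] H)) (χ : A →⋆ₐ[ℂ] ℂ) : Submodule ℂ H :=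
  (jointEigenspace π χ)ᗮ

/-- `H_S = ker Δ_R ∩ M_χ(π)`. -/
noncomputable abbrev spaceHS (π : A →⋆ₐ[ℂ] (H →L[ℂ] H)) (R : H →L[ℂ] K) (χ : A →⋆ₐ[ℂ] ℂ) :
    Submodule ℂ H :=
  LinearMap.ker (defectOp R : H →ₗ[ℂ] H) ⊓ jointEigenspace π χ

/-- `K_U = L_χᗮ`. -/
noncomputable abbrev spaceKU (π : A →⋆ₐ[ℂ] (H →L[ℂ] H)) (ρ : A →⋆ₐ[ℂ] (K →L[ℂ] K))
    (R : H →L[ℂ] K) (χ : A →⋆ₐ[ℂ] ℂ) : Submodule ℂ K :=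
  (spaceL π ρ R χ)ᗮ

/-- `K_S`, the intersection of `L_χ` with the orthogonal complement of the closure of
`ran (R Δ_R)`. -/
noncomputable abbrev spaceKS (π : A →⋆ₐ[ℂ] (H →L[ℂ] H)) (ρ : A →⋆ₐ[ℂ] (K →L[ℂ] K))
    (R : H →L[ℂ] K) (χ : A →⋆ₐ[ℂ] ℂ) : Submodule ℂ K :=
  (spaceKPC R)ᗮ ⊓ spaceL π ρ R χ

end Representations

end RDilation

/-! Write `D` for the square root of `Δ_R`. The operator `V x = (R x, D x)` from `H` to `K ⊕ H` is
an isometry. Since `χ` vanishes on `G`, compressing `ρ ⊕ χ` by `V` gives `R* ρ(g) R = π(g)` for `g ∈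
G`. Hyperrigidity makes `π` the only such extension of its restriction to `G`
(`IsHyperrigid.eq_compression`), so the compression is `π` on all of `A`. An isometry with a
multiplicative compression intertwines (`intertwines_of_eq_compression`), whence `R π(a) = ρ(a) R`
and `Δ_R π(a) = χ(a) Δ_R` (`IsHyperrigid.intertwines`).

The rest is geometry. Adjoints of the second relation put `ran Δ_R` inside `M_χ(π)`; the first puts
`L_χ` inside the joint eigenspace of `ρ`. This gives the orthogonal sums, the reducing subspaces and
the scalar action. On `ker Δ_R` the operator `R` preserves inner products, and off it `R` strictly
decreases norms. By minimality and the first relation, `R` has dense range. Hence `R_U` is onto, and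
`ker R*` and both defect spaces are zero.

Unique extension comes from applying hyperrigidity to a constant sequence of maps on a direct sum.
This requires a faithful representation of `A` on a separable space, obtained by GNS from a strictly
positive functional. -/

namespace RDilation

/-! ### Faithful representations of separable C⋆-algebras -/

section FaithfulRepresentation

variable {A : Type*} [CStarAlgebra A]

theorem countable_submonoidClosure {M : Type*} [Monoid M] {s : Set M} (hs : s.Countable) :
    (Submonoid.closure s : Set M).Countable := by
  have : Countable s := hs
  refine (Set.countable_range fun l : List s => (l.map (↑)).prod).mono fun x hx => ?_
  obtain ⟨l, hl, rfl⟩ := Submonoid.exists_list_of_mem_closure hx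
  lift l to List s using hl
  exact ⟨l, rfl⟩

/-- A C⋆-algebra with a countable set of generators is separable. -/
theorem separableSpace_of_generates {G : Set A} (hG : G.Countable)
    (hgen : (StarAlgebra.adjoin ℂ G).topologicalClosure = ⊤) :
    TopologicalSpace.SeparableSpace A := by
  have hstar : (star G).Countable := by
    rw [← Set.image_star]
    exact hG.image _
  -- The star algebra generated by `G` is the span of the countably many words in `G ∪ star G`.
  have hsep : TopologicalSpace.IsSeparable (StarAlgebra.adjoin ℂ G : Set A) := by
    have : (StarAlgebra.adjoin ℂ G : Set A) =
        Submodule.span ℂ (Submonoid.closure (G ∪ star G) : Set A) := by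
      rw [← Algebra.adjoin_eq_span]
      rfl
    rw [this]
    exact (countable_submonoidClosure (hG.union hstar)).isSeparable.span
  rw [← TopologicalSpace.isSeparable_univ_iff]
  convert hsep.closure
  rw [← StarSubalgebra.topologicalClosure_coe, hgen]
  rfl

theorem exists_pos_summable (ι : Type*) [Countable ι] :
    ∃ ε : ι → ℝ, (∀ i, 0 < ε i) ∧ Summable ε := by
  obtain ⟨ε, hε, _, hsum, _⟩ := NNReal.exists_pos_sum_of_countable one_ne_zero ι
  exact ⟨fun i => ε i, fun i => hε i, NNReal.summable_coe.mpr hsum.summable⟩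

/-- Countably many positive functionals are dominated, up to scaling, by a single one. -/
theorem exists_dominating_positive_functional [PartialOrder A] {ι : Type*} [Countable ι]
    (F : ι → StrongDual ℝ A)
    (hF : ∀ i x, 0 ≤ x → 0 ≤ F i x) :
    ∃ f : StrongDual ℝ A, (∀ x, 0 ≤ x → 0 ≤ f x) ∧ ∀ i x, 0 ≤ x → 0 < F i x → 0 < f x := by
  obtain ⟨ε, hε, hεsum⟩ := exists_pos_summable ι
  -- These weights give `‖c i • F i‖ ≤ ε i`, so the series converges in norm; the `1 +` guards
  -- against `F i = 0`.
  let c : ι → ℝ := fun i => ε i / (1 + ‖F i‖)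
  have hc : ∀ i, 0 < c i := fun i => div_pos (hε i) (by positivity)
  have hsum : Summable fun i => c i • F i := by
    refine Summable.of_norm_bounded hεsum fun i => ?_
    rw [norm_smul, Real.norm_of_nonneg (hc i).le, div_mul_eq_mul_div, div_le_iff₀ (by positivity)]
    exact mul_le_mul_of_nonneg_left (by linarith) (hε i).le
  obtain ⟨f, hf⟩ := hsum
  have happ : ∀ x, HasSum (fun i => c i * F i x) (f x) := fun x =>
    hf.mapL (ContinuousLinearMap.apply ℝ ℝ x)
  have hnonneg : ∀ x, 0 ≤ x → ∀ i, 0 ≤ c i * F i x :=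
    fun x hx i => mul_nonneg (hc i).le (hF i x hx)
  refine ⟨f, fun x hx => (happ x).nonneg (hnonneg x hx), fun i x hx hi => ?_⟩
  exact (mul_pos (hc i) hi).trans_le (le_hasSum (happ x) i fun j _ => hnonneg x hx j)

variable [PartialOrder A] [StarOrderedRing A]

/-- The closed convex cone of nonnegative elements of a C⋆-algebra. -/
def nonnegCone (A : Type*) [CStarAlgebra A] [PartialOrder A] [StarOrderedRing A] :
    ProperCone ℝ A where
  carrier := {a | 0 ≤ a}
  add_mem' := add_nonneg
  zero_mem' := le_rfl
  smul_mem' c _ hx := smul_nonneg c.2 hx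
  isClosed' := CStarAlgebra.isClosed_nonneg

/-- Hahn–Banach: `f` separates `-(a* a)` from the closed cone of nonnegative elements. -/
theorem exists_positive_functional_ne_zero {a : A} (ha : a ≠ 0) :
    ∃ f : StrongDual ℝ A, (∀ x, 0 ≤ x → 0 ≤ f x) ∧ 0 < f (star a * a) := by
  have hnot : -(star a * a) ∉ nonnegCone A := fun h => by
    have h' : star a * a ≤ 0 := neg_nonneg.mp h
    exact ha (CStarRing.star_mul_self_eq_zero_iff a |>.mp
      (le_antisymm h' (star_mul_self_nonneg a)))
  obtain ⟨f, hf, hfa⟩ := (nonnegCone A).hyperplane_separation_point hnot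
  exact ⟨f, hf, by simpa using hfa⟩

/-- A separable C⋆-algebra has a strictly positive functional. -/
theorem exists_faithful_positive_functional [TopologicalSpace.SeparableSpace A] :
    ∃ f : StrongDual ℝ A, (∀ x, 0 ≤ x → 0 ≤ f x) ∧ ∀ a, a ≠ 0 → 0 < f (star a * a) := by
  have : SecondCountableTopology A := UniformSpace.secondCountable_of_separable A
  choose F hF hFpos using fun a : {a : A // a ≠ 0} => exists_positive_functional_ne_zero a.2
  let U : {a : A // a ≠ 0} → Set A := fun i => {a | 0 < F i (star a * a)}
  have hU : ∀ i, IsOpen (U i) := fun i =>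
    isOpen_lt continuous_const ((F i).continuous.comp (continuous_star.mul continuous_id))
  -- Lindelöf: countably many of the open sets `U i` already cover the nonzero elements.
  obtain ⟨T, hT, hTU⟩ := TopologicalSpace.isOpen_iUnion_countable U hU
  have : Countable T := hT
  obtain ⟨f, hf, hpos⟩ := exists_dominating_positive_functional (fun i : T => F i) fun i => hF i
  refine ⟨f, hf, fun a ha => ?_⟩
  have hmem : a ∈ ⋃ i, U i := Set.mem_iUnion.mpr ⟨⟨a, ha⟩, hFpos _⟩
  rw [← hTU] at hmem
  obtain ⟨i, hi, hia⟩ := Set.mem_iUnion₂.mp hmem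
  exact hpos ⟨i, hi⟩ _ (star_mul_self_nonneg a) hia

open scoped ComplexOrder in
/-- The complex positive functional which agrees with `f` on self-adjoint elements. -/
noncomputable def complexifyPositive (f : StrongDual ℝ A) (hf : ∀ x, 0 ≤ x → 0 ≤ f x) :
    A →ₚ[ℂ] ℂ :=
  PositiveLinearMap.mk₀ (Module.Dual.extendRCLike (𝕜 := ℂ)
    (f.toLinearMap ∘ₗ (selfAdjoint.submodule ℝ A).subtype ∘ₗ realPart)) fun x hx => by
      have h1 : (realPart x : A) = x := (IsSelfAdjoint.of_nonneg hx).coe_realPart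
      have h2 : imaginaryPart x = 0 := (IsSelfAdjoint.of_nonneg hx).imaginaryPart
      rw [Complex.nonneg_iff]
      refine ⟨(hf x hx).trans_eq ?_, ?_⟩
      · refine Eq.trans ?_ (Module.Dual.re_extendRCLike_apply (𝕜 := ℂ) _ x).symm
        exact congrArg f h1.symm
      · refine Eq.trans ?_ (Module.Dual.im_extendRCLike_apply (𝕜 := ℂ) _ x).symm
        -- The imaginary part of the extension at `x` is `-f(Re(i x))`, and `Re(i x) = -Im x = 0`
        -- for self-adjoint `x`.
        have h3 : realPart (Complex.I • x) = 0 := by rw [realPart_I_smul, h2, neg_zero]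
        exact (neg_eq_zero.mpr ((congrArg (fun y : selfAdjoint A => f y) h3).trans f.map_zero)).symm

open scoped ComplexOrder in
theorem re_complexifyPositive (f : StrongDual ℝ A) (hf : ∀ x, 0 ≤ x → 0 ≤ f x) (x : A) :
    (complexifyPositive f hf x).re = f (realPart x : A) :=
  Module.Dual.re_extendRCLike_apply (𝕜 := ℂ) _ x

-- An element acting as zero kills the cyclic vector, the class of `1`, so its own class has norm
-- zero, that is, `f(a* a) = 0`.
open scoped ComplexOrder in
theorem gnsStarAlgHom_injective (f : A →ₚ[ℂ] ℂ) (hf : ∀ a, a ≠ 0 → f (star a * a) ≠ 0) :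
    Function.Injective f.gnsStarAlgHom := by
  refine (injective_iff_map_eq_zero _).mpr fun a ha => ?_
  by_contra hne
  have h1 : f.gnsStarAlgHom a (f.toPreGNS 1 : f.PreGNS) = (f.toPreGNS a : f.PreGNS) := by
    simp
  have h2 : ‖f.toPreGNS a‖ = 0 := by
    rw [← UniformSpace.Completion.norm_coe, ← h1, ha]
    simp
  have h3 := f.preGNS_norm_sq (f.toPreGNS a)
  rw [h2] at h3
  exact hf a hne (by simpa using h3.symm)

-- The class map from `A` is continuous, since `f(a* a) ≤ C ‖a‖²`, and its image is dense in the
-- completion.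
open scoped ComplexOrder in
theorem separableSpace_GNS [TopologicalSpace.SeparableSpace A] (f : A →ₚ[ℂ] ℂ) :
    TopologicalSpace.SeparableSpace f.GNS := by
  have hcont : Continuous f.toPreGNS := by
    obtain ⟨C, hC⟩ := f.exists_norm_apply_le
    refine (AddMonoidHomClass.lipschitz_of_bound f.toPreGNS (√C) fun a => ?_).continuous
    rw [← Real.sqrt_sq (norm_nonneg a), ← Real.sqrt_mul C.coe_nonneg, f.preGNS_norm_def]
    refine Real.sqrt_le_sqrt ((Complex.re_le_norm _).trans ((hC _).trans_eq ?_))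
    rw [f.ofPreGNS_toPreGNS, CStarRing.norm_star_mul_self, sq]
  have : TopologicalSpace.SeparableSpace f.PreGNS :=
    f.toPreGNS.surjective.denseRange.separableSpace hcont
  infer_instance

end FaithfulRepresentation

/-- A separable C⋆-algebra has a faithful representation on a separable Hilbert space. -/
theorem exists_faithful_representation.{u} (A : Type u) [CStarAlgebra A]
    [TopologicalSpace.SeparableSpace A] :
    ∃ (L : Type u) (_ : NormedAddCommGroup L) (_ : InnerProductSpace ℂ L) (_ : CompleteSpace L)
      (_ : TopologicalSpace.SeparableSpace L) (σ : A →⋆ₐ[ℂ] (L →L[ℂ] L)),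
      Function.Injective σ := by
  let _ := CStarAlgebra.spectralOrder A
  have := CStarAlgebra.spectralOrderedRing A
  obtain ⟨f, hf, hpos⟩ := exists_faithful_positive_functional (A := A)
  refine ⟨(complexifyPositive f hf).GNS, inferInstance, inferInstance, inferInstance,
    separableSpace_GNS _, (complexifyPositive f hf).gnsStarAlgHom,
    gnsStarAlgHom_injective _ fun a ha h => (hpos a ha).ne' ?_⟩
  have := re_complexifyPositive f hf (star a * a)
  rw [h, (IsSelfAdjoint.star_mul_self a).coe_realPart] at this
  exact this.symm

/-! ### Completely positive maps built from conjugations -/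

section ConjugationMap

variable {B : Type*} [CStarAlgebra B] [PartialOrder B] [StarOrderedRing B]

theorem map_conjugate_nonneg (x : B) {k : ℕ} (M : CStarMatrix (Fin k) (Fin k) B) (hM : 0 ≤ M) :
    0 ≤ M.map fun b => star x * b * x := by
  let D : CStarMatrix (Fin k) (Fin k) B := CStarMatrix.ofMatrix (Matrix.diagonal fun _ => x)
  have hD : ∀ i j, D i j = if i = j then x else 0 := fun i j => Matrix.diagonal_apply ..
  have h : (M.map fun b => star x * b * x) = star D * M * D := by
    ext i j
    simp [CStarMatrix.mul_apply, CStarMatrix.star_apply, hD, apply_ite star]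
  rw [h]
  exact star_left_conjugate_nonneg hM D

/-- The completely positive map `b ↦ x* b x + y* b y`. -/
def conjugationCP (x y : B) : B →CP B where
  toFun b := star x * b * x + star y * b * y
  map_add' a b := by noncomm_ring
  map_smul' c b := by simp
  map_cstarMatrix_nonneg' k M hM :=
    add_nonneg (map_conjugate_nonneg x M hM) (map_conjugate_nonneg y M hM)

theorem conjugationCP_apply (x y b : B) :
    conjugationCP x y b = star x * b * x + star y * b * y := rfl

end ConjugationMap

/-! ### Hyperrigidity on separable Hilbert spaces in any universe -/

section Transfer

theorem countable_of_orthonormal {L ι : Type*} [NormedAddCommGroup L] [InnerProductSpace ℂ L]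
    [TopologicalSpace.SeparableSpace L] {v : ι → L} (hv : Orthonormal ℂ v) : Countable ι := by
  refine Pairwise.countable_of_isOpen_disjoint (s := fun i => Metric.ball (v i) (1 / 2))
    (fun i j hij => Metric.ball_disjoint_ball ?_) (fun i => Metric.isOpen_ball)
    fun i => Metric.nonempty_ball.mpr (by norm_num)
  have h := @norm_sub_sq ℂ L _ _ _ (v i) (v j)
  rw [hv.2 hij, hv.1 i, hv.1 j] at h
  rw [dist_eq_norm]
  norm_num at h ⊢
  nlinarith [norm_nonneg (v i - v j)]

/-- Every separable Hilbert space is isometric to `ℓ²(s)` for some `s ⊆ ℕ`. -/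
theorem exists_linearIsometryEquiv_type (L : Type*) [NormedAddCommGroup L] [InnerProductSpace ℂ L]
    [CompleteSpace L] [TopologicalSpace.SeparableSpace L] :
    ∃ s : Set ℕ, Nonempty (L ≃ₗᵢ[ℂ] lp (fun _ : s => ℂ) 2) := by
  obtain ⟨w, b, hb⟩ := exists_hilbertBasis ℂ L
  have : Countable w := countable_of_orthonormal b.orthonormal
  obtain ⟨f, hf⟩ := exists_injective_nat w
  let e := Equiv.ofInjective f hf
  have hon : Orthonormal ℂ fun i : Set.range f => b (e.symm i) :=
    b.orthonormal.comp _ e.symm.injective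
  refine ⟨Set.range f, ⟨(HilbertBasis.mk hon ?_).repr⟩⟩
  rw [← b.dense_span]
  rw [← Function.Surjective.range_comp e.symm.surjective b]
  rfl

/-- The embedding `E` carries the problem to a space in `Type`, where hyperrigidity is defined;
conjugation by `E x` and `E y` respects the image of `E`. -/
theorem IsHyperrigid.rigid_conjugation_of_embedding {A : Type*} [CStarAlgebra A] {G : Set A}
    (hG : IsHyperrigid G) {L : Type} [NormedAddCommGroup L] [InnerProductSpace ℂ L]
    [CompleteSpace L] [TopologicalSpace.SeparableSpace L] {B : Type*} [CStarAlgebra B]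
    (E : B →⋆ₐ[ℂ] (L →L[ℂ] L)) (hE : Function.Injective E) (σ : A →⋆ₐ[ℂ] B)
    (hσ : Function.Injective σ) (x y : B) (hxy : star x * x + star y * y = 1)
    (h : ∀ g ∈ G, star x * σ g * x + star y * σ g * y = σ g) (a : A) :
    star x * σ a * x + star y * σ a * y = σ a := by
  have hτ : ∀ b, conjugationCP (E x) (E y) (E b) = E (star x * b * x + star y * b * y) := fun b => by
    simp only [conjugationCP_apply, map_add, map_mul, map_star]
  have key := hG.rigid L (E.comp σ) (hE.comp hσ) (fun _ => conjugationCP (E x) (E y))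
    (fun _ => by
      rw [← map_one E, hτ, mul_one, mul_one, hxy])
    (fun g hg => by
      rw [StarAlgHom.comp_apply, hτ, h g hg]
      simp) a
  -- The sequence of maps is constant, so its limit zero is its value.
  have h0 := tendsto_nhds_unique key tendsto_const_nhds
  rw [eq_comm, norm_eq_zero, sub_eq_zero, StarAlgHom.comp_apply, hτ] at h0
  exact hE h0

/-- Hyperrigidity, for Hilbert spaces in any universe and for unital completely positive maps of
the form `T ↦ x* T x + y* T y`. -/
theorem IsHyperrigid.rigid_conjugation {A : Type*} [CStarAlgebra A] {G : Set A}
    (hG : IsHyperrigid G) {L : Type*} [NormedAddCommGroup L] [InnerProductSpace ℂ L]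
    [CompleteSpace L] [TopologicalSpace.SeparableSpace L] (σ : A →⋆ₐ[ℂ] (L →L[ℂ] L))
    (hσ : Function.Injective σ) (x y : L →L[ℂ] L) (hxy : star x * x + star y * y = 1)
    (h : ∀ g ∈ G, star x * σ g * x + star y * σ g * y = σ g) (a : A) :
    star x * σ a * x + star y * σ a * y = σ a := by
  obtain ⟨s, ⟨e⟩⟩ := exists_linearIsometryEquiv_type L
  have : TopologicalSpace.SeparableSpace (lp (fun _ : s => ℂ) 2) :=
    e.surjective.denseRange.separableSpace e.continuous
  exact hG.rigid_conjugation_of_embedding e.conjStarAlgEquiv.toStarAlgHom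
    e.conjStarAlgEquiv.injective σ hσ x y hxy h a

end Transfer

/-! ### Direct sums of operators and representations -/

section DirectSum

variable {A : Type*} [CStarAlgebra A]
  {E F : Type*} [NormedAddCommGroup E] [InnerProductSpace ℂ E]
  [NormedAddCommGroup F] [InnerProductSpace ℂ F]

/-- The operator `S ⊕ T` on the Hilbert space direct sum. -/
noncomputable def directSumOp (S : E →L[ℂ] E) (T : F →L[ℂ] F) :
    WithLp 2 (E × F) →L[ℂ] WithLp 2 (E × F) :=
  (WithLp.prodContinuousLinearEquiv 2 ℂ E F).symm.toContinuousLinearMap ∘L S.prodMap T ∘L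
    (WithLp.prodContinuousLinearEquiv 2 ℂ E F).toContinuousLinearMap

theorem directSumOp_apply (S : E →L[ℂ] E) (T : F →L[ℂ] F) (z : WithLp 2 (E × F)) :
    directSumOp S T z = WithLp.toLp 2 (S z.fst, T z.snd) := rfl

/-- The inclusion of the first summand. -/
noncomputable def sumInl (E F : Type*) [NormedAddCommGroup E] [InnerProductSpace ℂ E]
    [NormedAddCommGroup F] [InnerProductSpace ℂ F] : E →L[ℂ] WithLp 2 (E × F) :=
  (WithLp.prodContinuousLinearEquiv 2 ℂ E F).symm.toContinuousLinearMap ∘L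
    ContinuousLinearMap.inl ℂ E F

/-- The inclusion of the second summand. -/
noncomputable def sumInr (E F : Type*) [NormedAddCommGroup E] [InnerProductSpace ℂ E]
    [NormedAddCommGroup F] [InnerProductSpace ℂ F] : F →L[ℂ] WithLp 2 (E × F) :=
  (WithLp.prodContinuousLinearEquiv 2 ℂ E F).symm.toContinuousLinearMap ∘L
    ContinuousLinearMap.inr ℂ E F

theorem sumInl_apply (x : E) : sumInl E F x = WithLp.toLp 2 (x, 0) := rfl

theorem sumInr_apply (y : F) : sumInr E F y = WithLp.toLp 2 (0, y) := rfl

variable [CompleteSpace E] [CompleteSpace F]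

theorem adjoint_sumInl : ContinuousLinearMap.adjoint (sumInl E F) = WithLp.fstL 2 ℂ E F := by
  refine ((ContinuousLinearMap.eq_adjoint_iff _ _).mpr fun z x => ?_).symm
  simp [sumInl_apply, WithLp.prod_inner_apply]

theorem adjoint_sumInr : ContinuousLinearMap.adjoint (sumInr E F) = WithLp.sndL 2 ℂ E F := by
  refine ((ContinuousLinearMap.eq_adjoint_iff _ _).mpr fun z y => ?_).symm
  simp [sumInr_apply, WithLp.prod_inner_apply]

theorem adjoint_fstL : ContinuousLinearMap.adjoint (WithLp.fstL 2 ℂ E F) = sumInl E F := by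
  rw [← adjoint_sumInl, ContinuousLinearMap.adjoint_adjoint]

theorem adjoint_sndL : ContinuousLinearMap.adjoint (WithLp.sndL 2 ℂ E F) = sumInr E F := by
  rw [← adjoint_sumInr, ContinuousLinearMap.adjoint_adjoint]

/-- The direct sum of two representations. -/
noncomputable def directSumRep (σ : A →⋆ₐ[ℂ] (E →L[ℂ] E)) (τ : A →⋆ₐ[ℂ] (F →L[ℂ] F)) :
    A →⋆ₐ[ℂ] (WithLp 2 (E × F) →L[ℂ] WithLp 2 (E × F)) where
  toFun a := directSumOp (σ a) (τ a)
  map_one' := by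
    ext z; simp [directSumOp_apply]; rfl
  map_mul' a b := by ext z; simp [directSumOp_apply]
  map_zero' := by ext z; simp [directSumOp_apply]
  map_add' a b := by
    ext z; simp [directSumOp_apply]; rfl
  commutes' c := by
    ext z; simp [directSumOp_apply, Algebra.algebraMap_eq_smul_one]; rfl
  map_star' a := by
    refine (ContinuousLinearMap.eq_adjoint_iff _ _).mpr fun z w => ?_
    simp [directSumOp_apply, WithLp.prod_inner_apply, map_star, ContinuousLinearMap.star_eq_adjoint,
      ContinuousLinearMap.adjoint_inner_left]

theorem directSumRep_apply (σ : A →⋆ₐ[ℂ] (E →L[ℂ] E)) (τ : A →⋆ₐ[ℂ] (F →L[ℂ] F)) (a : A)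
    (z : WithLp 2 (E × F)) :
    directSumRep σ τ a z = WithLp.toLp 2 (σ a z.fst, τ a z.snd) := rfl

theorem directSumRep_injective_of_right (σ : A →⋆ₐ[ℂ] (E →L[ℂ] E)) (τ : A →⋆ₐ[ℂ] (F →L[ℂ] F))
    (hτ : Function.Injective τ) : Function.Injective (directSumRep σ τ) := by
  refine fun a b hab => hτ (ContinuousLinearMap.ext fun y => ?_)
  exact congrArg WithLp.snd (DFunLike.congr_fun hab (WithLp.toLp 2 (0, y)))

end DirectSum

/-! ### Unique extension from a hyperrigid set -/

section UniqueExtension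

variable {A : Type*} [CStarAlgebra A] {G : Set A}
  {H : Type*} [NormedAddCommGroup H] [InnerProductSpace ℂ H] [CompleteSpace H]
  {Y : Type*} [NormedAddCommGroup Y] [InnerProductSpace ℂ Y] [CompleteSpace Y]

open ContinuousLinearMap in
/-- An isometry whose compression of a representation is multiplicative intertwines. -/
theorem intertwines_of_eq_compression
    (π : A →⋆ₐ[ℂ] (H →L[ℂ] H)) (τ : A →⋆ₐ[ℂ] (Y →L[ℂ] Y)) (V : H →L[ℂ] Y)
    (hV : adjoint V ∘L V = .id ℂ H) (h : ∀ a, π a = adjoint V ∘L τ a ∘L V) (a : A) (x : H) :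
    V (π a x) = τ a (V x) := by
  have hinner : ∀ u w, inner ℂ (V u) (V w) = inner ℂ u w := fun u w => by
    rw [← adjoint_inner_right]
    exact congrArg (inner ℂ u) (DFunLike.congr_fun hV w)
  -- All four terms of `‖V π(a) x - τ(a) V x‖²` equal `‖π(a) x‖²`; this one uses the hypothesis at
  -- `a* a`.
  have hstar : inner ℂ (τ a (V x)) (τ a (V x)) = inner ℂ (π a x) (π a x) := by
    have h1 : inner ℂ x (π (star a * a) x) = inner ℂ (V x) (τ (star a * a) (V x)) := by
      rw [h, ← adjoint_inner_right]
      rfl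
    rw [map_mul, map_mul, map_star, map_star] at h1
    simpa [star_eq_adjoint, adjoint_inner_right] using h1.symm
  have hcross : inner ℂ (V (π a x)) (τ a (V x)) = inner ℂ (π a x) (π a x) := by
    rw [← adjoint_inner_right]
    exact congrArg (inner ℂ (π a x)) (DFunLike.congr_fun (h a) x).symm
  have hcross' : inner ℂ (τ a (V x)) (V (π a x)) = inner ℂ (π a x) (π a x) := by
    rw [← inner_conj_symm, hcross, inner_conj_symm]
  rw [← sub_eq_zero, ← inner_self_eq_zero (𝕜 := ℂ), inner_sub_sub_self, hinner, hcross, hcross',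
    hstar]
  ring

variable [TopologicalSpace.SeparableSpace H] [TopologicalSpace.SeparableSpace Y]

-- On `H ⊕ Y`, which carries the faithful `π ⊕ τ`, take `x (h, u) = (0, V h)` and `y (h, u) = (0,
-- u)`. The map `T ↦ x* T x + y* T y` sends `π(b) ⊕ τ(b)` to `V* τ(b) V ⊕ τ(b)`, so fixing `G`
-- forces it to fix all of `A`.
open ContinuousLinearMap in
theorem IsHyperrigid.eq_compression_of_injective (hG : IsHyperrigid G)
    (π : A →⋆ₐ[ℂ] (H →L[ℂ] H)) (τ : A →⋆ₐ[ℂ] (Y →L[ℂ] Y)) (hτ : Function.Injective τ)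
    (V : H →L[ℂ] Y) (hV : adjoint V ∘L V = .id ℂ H)
    (h : ∀ g ∈ G, π g = adjoint V ∘L τ g ∘L V) (a : A) :
    π a = adjoint V ∘L τ a ∘L V := by
  let σ := directSumRep π τ
  let x := sumInr H Y ∘L V ∘L WithLp.fstL 2 ℂ H Y
  let y := sumInr H Y ∘L WithLp.sndL 2 ℂ H Y
  have hx : ∀ z, star x z = WithLp.toLp 2 (adjoint V z.snd, 0) := fun z => by
    simp [x, star_eq_adjoint, adjoint_comp, adjoint_sumInr, adjoint_fstL, sumInl_apply]
  have hy : ∀ z, star y z = WithLp.toLp 2 (0, z.snd) := fun z => by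
    simp [y, star_eq_adjoint, adjoint_comp, adjoint_sumInr, adjoint_sndL, sumInr_apply]
  have hΦ : ∀ b z, (star x * σ b * x + star y * σ b * y) z =
      WithLp.toLp 2 ((adjoint V ∘L τ b ∘L V) z.fst, τ b z.snd) := fun b z => by
    change star x (σ b (x z)) + star y (σ b (y z)) = _
    rw [hx, hy]
    simp [σ, directSumRep_apply, x, y, sumInr_apply, ← WithLp.toLp_add]
  have key := hG.rigid_conjugation σ (directSumRep_injective_of_right π τ hτ) x y
    (by
      ext1 z
      have hVz : adjoint V (V z.fst) = z.fst := DFunLike.congr_fun hV z.fst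
      have h1 : WithLp.toLp 2 ((adjoint V ∘L τ 1 ∘L V) z.fst, τ 1 z.snd) = z := by
        rw [map_one]
        exact congrArg (fun u => WithLp.toLp 2 (u, z.snd)) hVz
      simpa using (hΦ 1 z).trans h1)
    (fun g hg => by
      ext1 z
      rw [hΦ, ← h g hg]
      rfl) a
  ext u
  have := congrArg WithLp.fst ((hΦ a (sumInl H Y u)).symm.trans (DFunLike.congr_fun key _))
  exact this.symm

open ContinuousLinearMap in
/-- A representation is the only unital completely positive extension of its restriction to a
hyperrigid set, among the compressions of representations on separable spaces. -/
theorem IsHyperrigid.eq_compression (hG : IsHyperrigid G)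
    (π : A →⋆ₐ[ℂ] (H →L[ℂ] H)) (τ : A →⋆ₐ[ℂ] (Y →L[ℂ] Y))
    (V : H →L[ℂ] Y) (hV : adjoint V ∘L V = .id ℂ H)
    (h : ∀ g ∈ G, π g = adjoint V ∘L τ g ∘L V) (a : A) :
    π a = adjoint V ∘L τ a ∘L V := by
  have := separableSpace_of_generates hG.countable hG.generates
  -- Adding a faithful summand makes `τ` faithful; `V` maps into the first summand, so the
  -- compression is unchanged.
  obtain ⟨L, _, _, _, _, σ, hσ⟩ := exists_faithful_representation A
  have hcomp : ∀ b, adjoint (sumInl Y L ∘L V) ∘L directSumRep τ σ b ∘L (sumInl Y L ∘L V) =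
      adjoint V ∘L τ b ∘L V := fun b => by
    rw [adjoint_comp, adjoint_sumInl]
    rfl
  rw [← hcomp]
  refine hG.eq_compression_of_injective π _ (directSumRep_injective_of_right τ σ hσ) _ ?_
    (fun g hg => by rw [hcomp, h g hg]) a
  rw [← hV, adjoint_comp, adjoint_sumInl]
  rfl

end UniqueExtension

/-! ### The defect operator and its square root -/

section DefectOperator

variable {H K : Type*} [NormedAddCommGroup H] [InnerProductSpace ℂ H] [CompleteSpace H]
  [NormedAddCommGroup K] [InnerProductSpace ℂ K] [CompleteSpace K]

open ContinuousLinearMap in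
theorem inner_defectOp (R : H →L[ℂ] K) (x y : H) :
    inner ℂ (defectOp R x) y = inner ℂ x y - inner ℂ (R x) (R y) := by
  simp [defectOp, adjoint_inner_left]

theorem isSelfAdjoint_defectOp (R : H →L[ℂ] K) : IsSelfAdjoint (defectOp R) := by
  refine ContinuousLinearMap.isSelfAdjoint_iff_isSymmetric.mpr fun x y => ?_
  change inner ℂ (defectOp R x) y = inner ℂ x (defectOp R y)
  rw [inner_defectOp, ← inner_conj_symm x (defectOp R y), inner_defectOp, map_sub,
    inner_conj_symm, inner_conj_symm]

theorem inner_defectOp_right (R : H →L[ℂ] K) (x y : H) :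
    inner ℂ x (defectOp R y) = inner ℂ x y - inner ℂ (R x) (R y) := by
  rw [← inner_defectOp]
  exact ((ContinuousLinearMap.isSelfAdjoint_iff_isSymmetric.mp (isSelfAdjoint_defectOp R)) x y).symm

theorem defectOp_nonneg {R : H →L[ℂ] K} (hR : ‖R‖ ≤ 1) : 0 ≤ defectOp R := by
  refine (ContinuousLinearMap.nonneg_iff_isPositive _).mpr
    ((ContinuousLinearMap.isPositive_iff_complex _).mpr fun x => ?_)
  have h : inner ℂ (defectOp R x) x = ((‖x‖ ^ 2 - ‖R x‖ ^ 2 : ℝ) : ℂ) := by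
    rw [inner_defectOp, inner_self_eq_norm_sq_to_K, inner_self_eq_norm_sq_to_K]
    push_cast
    rfl
  have hle : ‖R x‖ ≤ ‖x‖ := (R.le_of_opNorm_le hR x).trans_eq (one_mul _)
  rw [h]
  refine ⟨by rw [RCLike.re_to_complex, Complex.ofReal_re], ?_⟩
  rw [RCLike.re_to_complex, Complex.ofReal_re]
  nlinarith [norm_nonneg (R x)]

open ContinuousLinearMap in
theorem exists_isSelfAdjoint_comp_self_eq_defectOp {R : H →L[ℂ] K} (hR : ‖R‖ ≤ 1) :
    ∃ D : H →L[ℂ] H, adjoint D = D ∧ D ∘L D = defectOp R :=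
  ⟨CFC.sqrt (defectOp R), (IsSelfAdjoint.of_nonneg (CFC.sqrt_nonneg _)).star_eq,
    CFC.sqrt_mul_sqrt_self _ (defectOp_nonneg hR)⟩

end DefectOperator

/-! ### The intertwining relations -/

section Intertwining

variable {A : Type*} [CStarAlgebra A] {G : Set A}
  {H K : Type*} [NormedAddCommGroup H] [InnerProductSpace ℂ H] [CompleteSpace H]
  [NormedAddCommGroup K] [InnerProductSpace ℂ K] [CompleteSpace K]

/-- The representation by the scalars `χ(a)`. -/
noncomputable def scalarRep (H : Type*) [NormedAddCommGroup H] [InnerProductSpace ℂ H]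
    [CompleteSpace H] (χ : A →⋆ₐ[ℂ] ℂ) : A →⋆ₐ[ℂ] (H →L[ℂ] H) :=
  (StarAlgHom.ofId ℂ (H →L[ℂ] H)).comp χ

theorem scalarRep_apply (χ : A →⋆ₐ[ℂ] ℂ) (a : A) (x : H) : scalarRep H χ a x = χ a • x := by
  change algebraMap ℂ (H →L[ℂ] H) (χ a) x = _
  simp [Algebra.algebraMap_eq_smul_one]

variable [TopologicalSpace.SeparableSpace H] [TopologicalSpace.SeparableSpace K]

open ContinuousLinearMap in
/-- The contraction `R` and its defect operator intertwine `π` with `ρ` and with `χ`. -/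
theorem IsHyperrigid.intertwines (hG : IsHyperrigid G)
    (χ : A →⋆ₐ[ℂ] ℂ) (hχ : ∀ g ∈ G, χ g = 0)
    (π : A →⋆ₐ[ℂ] (H →L[ℂ] H)) (ρ : A →⋆ₐ[ℂ] (K →L[ℂ] K))
    (R : H →L[ℂ] K) (hR : ‖R‖ ≤ 1) (hdil : ∀ g ∈ G, π g = adjoint R ∘L ρ g ∘L R)
    (a : A) (x : H) :
    R (π a x) = ρ a (R x) ∧ defectOp R (π a x) = χ a • defectOp R x := by
  obtain ⟨D, hD, hDD⟩ := exists_isSelfAdjoint_comp_self_eq_defectOp hR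
  let V : H →L[ℂ] WithLp 2 (K × H) := sumInl K H ∘L R + sumInr K H ∘L D
  have hVx : ∀ x, V x = WithLp.toLp 2 (R x, D x) := fun x => by
    simp [V, sumInl_apply, sumInr_apply, ← WithLp.toLp_add]
  have hVadj : ∀ z, adjoint V z = adjoint R z.fst + D z.snd := fun z => by
    simp [V, adjoint_comp, adjoint_sumInl, adjoint_sumInr, hD]
  have hV : adjoint V ∘L V = .id ℂ H := by
    ext1 x
    have hDx : D (D x) = x - adjoint R (R x) := DFunLike.congr_fun hDD x
    simp [hVx, hVadj, hDx]
  -- The scalar summand vanishes on `G`, so it does not disturb the compression there.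
  let τ := directSumRep ρ (scalarRep H χ)
  have hcomp : ∀ g ∈ G, π g = adjoint V ∘L τ g ∘L V := fun g hg => by
    ext1 x
    simp [hdil g hg, hVx, hVadj, τ, directSumRep_apply, scalarRep_apply, hχ g hg]
  have hint := intertwines_of_eq_compression π τ V hV (hG.eq_compression π τ V hV hcomp) a x
  rw [hVx, hVx, directSumRep_apply] at hint
  have h1 : R (π a x) = ρ a (R x) := congrArg WithLp.fst hint
  have h2 : D (π a x) = χ a • D x := (congrArg WithLp.snd hint).trans (scalarRep_apply χ a _)
  refine ⟨h1, ?_⟩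
  rw [← hDD, comp_apply, comp_apply, h2, map_smul]

end Intertwining

/-! ### Orthogonal sums, unitaries and reducing subspaces -/

section Geometry

variable {E F : Type*} [NormedAddCommGroup E] [InnerProductSpace ℂ E] [CompleteSpace E]
  [NormedAddCommGroup F] [InnerProductSpace ℂ F] [CompleteSpace F]

theorem isOrthogonalSum_orthogonal_inf {P Q : Submodule ℂ E}
    (hQ : IsClosed (Q : Set E)) (h : P ≤ Q) : IsOrthogonalSum Pᗮ Qᗮ (Pᗮ ⊓ Q) where
  isClosed_left := Submodule.isClosed_orthogonal _
  isClosed_right := (Submodule.isClosed_orthogonal _).inter hQ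
  isOrtho := (Submodule.isOrtho_orthogonal_left Q).mono_right inf_le_right
  sup_eq := by
    have : CompleteSpace Q := hQ.completeSpace_coe
    refine le_antisymm (sup_le (Submodule.orthogonal_le h) inf_le_left) fun x hx => ?_
    obtain ⟨q, hq, q', hq', rfl⟩ := Q.exists_add_mem_mem_orthogonal x
    refine add_comm q q' ▸ Submodule.add_mem_sup hq' ⟨?_, hq⟩
    simpa using Pᗮ.sub_mem hx (Submodule.orthogonal_le h hq')

theorem isOrthogonalSum_orthogonal {Q : Submodule ℂ E} (hQ : IsClosed (Q : Set E)) :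
    IsOrthogonalSum ⊤ Qᗮ Q := by
  simpa using isOrthogonalSum_orthogonal_inf hQ bot_le

theorem isUnitaryOperator_of_isometry {T : E →L[ℂ] F} (hT : Isometry T)
    (hran : (LinearMap.range (T : E →ₗ[ℂ] F))ᗮ = ⊥) : IsUnitaryOperator T := by
  have h1 := T.isometry_iff_adjoint_comp_self.mp hT
  refine ⟨h1, ?_⟩
  have hsurj : Function.Surjective T := by
    have hcl : IsClosed (LinearMap.range (T : E →ₗ[ℂ] F) : Set F) :=
      hT.isClosedEmbedding.isClosed_range
    have : CompleteSpace (LinearMap.range (T : E →ₗ[ℂ] F)) := hcl.completeSpace_coe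
    exact LinearMap.range_eq_top.mp (Submodule.orthogonal_eq_bot_iff.mp hran)
  ext y
  obtain ⟨x, rfl⟩ := hsurj y
  exact congrArg T (DFunLike.congr_fun h1 x)

variable {A : Type*} [CStarAlgebra A]

-- Invariance under `π(a*) = π(a)*` passes to the orthogonal complement.
open ContinuousLinearMap in
theorem reduces_of_map_mem (π : A →⋆ₐ[ℂ] (E →L[ℂ] E)) {M : Submodule ℂ E}
    (hM : IsClosed (M : Set E)) (h : ∀ a, ∀ x ∈ M, π a x ∈ M) : Reduces π M where
  isClosed := hM
  map_mem := h
  map_mem_orthogonal a x hx := fun y hy => by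
    rw [← adjoint_inner_left, ← star_eq_adjoint, ← map_star]
    exact hx _ (h (star a) y hy)

theorem Reduces.orthogonal {π : A →⋆ₐ[ℂ] (E →L[ℂ] E)} {M : Submodule ℂ E} (h : Reduces π M) :
    Reduces π Mᗮ :=
  reduces_of_map_mem π (Submodule.isClosed_orthogonal M) h.map_mem_orthogonal

theorem mem_jointEigenspace {π : A →⋆ₐ[ℂ] (E →L[ℂ] E)} {χ : A →⋆ₐ[ℂ] ℂ} {x : E} :
    x ∈ jointEigenspace π χ ↔ ∀ a, π a x = χ a • x := by
  simp [jointEigenspace, sub_eq_zero]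

theorem isClosed_jointEigenspace (π : A →⋆ₐ[ℂ] (E →L[ℂ] E)) (χ : A →⋆ₐ[ℂ] ℂ) :
    IsClosed (jointEigenspace π χ : Set E) := by
  have : (jointEigenspace π χ : Set E) = ⋂ a, {x | π a x = χ a • x} := by
    ext x
    simp [mem_jointEigenspace]
  rw [this]
  exact isClosed_iInter fun a => isClosed_eq (by fun_prop) (by fun_prop)

/-- Closed subspaces of the joint eigenspace reduce the representation. -/
theorem reduces_of_le_jointEigenspace {π : A →⋆ₐ[ℂ] (E →L[ℂ] E)} {χ : A →⋆ₐ[ℂ] ℂ}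
    {M : Submodule ℂ E} (hM : IsClosed (M : Set E)) (h : M ≤ jointEigenspace π χ) :
    Reduces π M :=
  reduces_of_map_mem π hM fun a x hx => by
    rw [mem_jointEigenspace.mp (h hx) a]
    exact M.smul_mem _ hx

end Geometry

/-! ### The action of `R` on the kernel and range of its defect operator -/

section DefectSpaces

variable {H K : Type*} [NormedAddCommGroup H] [InnerProductSpace ℂ H] [CompleteSpace H]
  [NormedAddCommGroup K] [InnerProductSpace ℂ K] [CompleteSpace K]

theorem isClosed_spaceHPC (R : H →L[ℂ] K) : IsClosed (spaceHPC R : Set H) :=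
  Submodule.isClosed_topologicalClosure _

theorem isClosed_spaceKPC (R : H →L[ℂ] K) : IsClosed (spaceKPC R : Set K) :=
  Submodule.isClosed_topologicalClosure _

theorem spaceHI_eq_orthogonal (R : H →L[ℂ] K) : spaceHI R = (spaceHPC R)ᗮ := by
  rw [spaceHPC, Submodule.orthogonal_closure, ContinuousLinearMap.orthogonal_range,
    (isSelfAdjoint_defectOp R).adjoint_eq]

theorem mem_spaceHI {R : H →L[ℂ] K} {x : H} : x ∈ spaceHI R ↔ defectOp R x = 0 :=
  LinearMap.mem_ker

theorem inner_map_of_mem_spaceHI {R : H →L[ℂ] K} {x : H} (hx : x ∈ spaceHI R) (y : H) :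
    inner ℂ (R x) (R y) = inner ℂ x y := by
  have h := inner_defectOp R x y
  rw [mem_spaceHI.mp hx, inner_zero_left] at h
  exact (sub_eq_zero.mp h.symm).symm

theorem norm_map_of_mem_spaceHI {R : H →L[ℂ] K} {x : H} (hx : x ∈ spaceHI R) : ‖R x‖ = ‖x‖ := by
  rw [@norm_eq_sqrt_re_inner ℂ, @norm_eq_sqrt_re_inner ℂ _ _ _ _ x, inner_map_of_mem_spaceHI hx]

/-- A contraction is isometric exactly on the kernel of its defect operator. -/
theorem mem_spaceHI_of_norm_le {R : H →L[ℂ] K} (hR : ‖R‖ ≤ 1) {x : H} (hx : ‖x‖ ≤ ‖R x‖) :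
    x ∈ spaceHI R := by
  obtain ⟨D, hD, hDD⟩ := exists_isSelfAdjoint_comp_self_eq_defectOp hR
  have hle : ‖R x‖ = ‖x‖ := le_antisymm ((R.le_of_opNorm_le hR x).trans_eq (one_mul _)) hx
  have h : inner ℂ (D x) (D x) = inner ℂ x x - inner ℂ (R x) (R x) := by
    rw [← inner_defectOp, ← hDD, ← ContinuousLinearMap.adjoint_inner_left, hD]
    rfl
  rw [inner_self_eq_norm_sq_to_K, inner_self_eq_norm_sq_to_K, inner_self_eq_norm_sq_to_K, hle,
    sub_self, sq_eq_zero_iff, RCLike.ofReal_eq_zero, norm_eq_zero] at h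
  rw [mem_spaceHI, ← hDD, ContinuousLinearMap.comp_apply, h, map_zero]

theorem map_mem_spaceKPC (R : H →L[ℂ] K) {x : H} (hx : x ∈ spaceHPC R) : R x ∈ spaceKPC R := by
  refine map_mem_closure R.continuous hx ?_
  rintro _ ⟨y, rfl⟩
  exact ⟨y, rfl⟩

theorem map_mem_spaceKI (R : H →L[ℂ] K) {x : H} (hx : x ∈ spaceHI R) : R x ∈ spaceKI R := by
  rw [spaceKI, spaceKPC, Submodule.orthogonal_closure, Submodule.mem_orthogonal']
  rintro _ ⟨y, rfl⟩
  change inner ℂ (R x) (R (defectOp R y)) = 0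
  rw [inner_map_of_mem_spaceHI hx, inner_defectOp_right, inner_map_of_mem_spaceHI hx, sub_self]

/-- A vector whose norm is not decreased lies in `ker Δ_R`, which is orthogonal to `ran Δ_R`. -/
theorem isPureContraction_restrict {R : H →L[ℂ] K} (hR : ‖R‖ ≤ 1) {T : Submodule ℂ K}
    (h : ∀ x ∈ spaceHPC R, R x ∈ T) : IsPureContraction (R.restrict h) := by
  intro x hx
  by_contra! hle
  have hI : (x : H) ∈ (spaceHPC R)ᗮ := by
    rw [← spaceHI_eq_orthogonal]
    exact mem_spaceHI_of_norm_le hR hle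
  exact hx (Subtype.ext (inner_self_eq_zero.mp (hI x x.2)))

theorem isometry_restrict {R : H →L[ℂ] K} {S : Submodule ℂ H} {T : Submodule ℂ K}
    (hS : S ≤ spaceHI R) (h : ∀ x ∈ S, R x ∈ T) : Isometry (R.restrict h) :=
  AddMonoidHomClass.isometry_of_norm _ fun x =>
    norm_map_of_mem_spaceHI (R := R) (hS x.2)

end DefectSpaces

/-! ### Eigenspaces, cyclic spans and the summands -/

section Decomposition

variable {A : Type*} [CStarAlgebra A]
  {H K : Type*} [NormedAddCommGroup H] [InnerProductSpace ℂ H] [CompleteSpace H]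
  [NormedAddCommGroup K] [InnerProductSpace ℂ K] [CompleteSpace K]
  {χ : A →⋆ₐ[ℂ] ℂ} {π : A →⋆ₐ[ℂ] (H →L[ℂ] H)} {ρ : A →⋆ₐ[ℂ] (K →L[ℂ] K)} {R : H →L[ℂ] K}

-- Taking adjoints in `Δ_R π(a*) = χ(a*) Δ_R` gives `π(a) Δ_R = χ(a) Δ_R`.
open ContinuousLinearMap in
theorem spaceHPC_le_jointEigenspace
    (hΔ : ∀ a x, defectOp R (π a x) = χ a • defectOp R x) : spaceHPC R ≤ jointEigenspace π χ := by
  refine Submodule.topologicalClosure_minimal _ ?_ (isClosed_jointEigenspace π χ)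
  rintro _ ⟨x, rfl⟩
  refine mem_jointEigenspace.mpr fun a => ext_inner_right ℂ fun y => ?_
  have hsymm := isSelfAdjoint_iff_isSymmetric.mp (isSelfAdjoint_defectOp R)
  have h1 : inner ℂ (defectOp R x) (π (star a) y) = inner ℂ x (defectOp R (π (star a) y)) :=
    hsymm x _
  have h2 : inner ℂ (defectOp R x) y = inner ℂ x (defectOp R y) := hsymm x y
  change inner ℂ (π a (defectOp R x)) y = inner ℂ (χ a • defectOp R x) y
  rw [← adjoint_inner_right, ← star_eq_adjoint, ← map_star, h1, hΔ, inner_smul_right,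
    inner_smul_left, h2, map_star]
  rfl

theorem isClosed_spaceL : IsClosed (spaceL π ρ R χ : Set K) :=
  Submodule.isClosed_topologicalClosure _

theorem map_mem_spaceL {x : H} (hx : x ∈ jointEigenspace π χ) : R x ∈ spaceL π ρ R χ := by
  refine Submodule.le_topologicalClosure _ (Submodule.mem_iSup_of_mem 1 ⟨x, hx, ?_⟩)
  simp

theorem spaceL_le_jointEigenspace (hint : ∀ a x, R (π a x) = ρ a (R x)) :
    spaceL π ρ R χ ≤ jointEigenspace ρ χ := by
  refine Submodule.topologicalClosure_minimal _ (iSup_le fun a => ?_) (isClosed_jointEigenspace ρ χ)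
  rintro _ ⟨x, hx, rfl⟩
  have hx' := mem_jointEigenspace.mp hx
  refine mem_jointEigenspace.mpr fun b => ?_
  change ρ b (ρ a (R x)) = χ b • ρ a (R x)
  simp only [← hint, hx', map_smul, smul_comm (χ b)]

/-- Intertwining gives `ρ(a) R(M) = R π(a)(M) ⊆ R(M)`, so testing against `R(M)` suffices. -/
theorem mem_orthogonal_cyclicSpan (hint : ∀ a x, R (π a x) = ρ a (R x)) {M : Submodule ℂ H}
    (hM : ∀ a, ∀ x ∈ M, π a x ∈ M) {y : K} (hy : ∀ x ∈ M, inner ℂ (R x) y = 0) :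
    y ∈ (cyclicSpan ρ R M)ᗮ := by
  rw [cyclicSpan, Submodule.orthogonal_closure, Submodule.mem_orthogonal]
  intro z hz
  refine Submodule.iSup_induction _ (motive := fun z => inner ℂ z y = 0) hz ?_ (inner_zero_left _)
    fun u v hu hv => by rw [inner_add_left, hu, hv, add_zero]
  rintro a _ ⟨x, hx, rfl⟩
  change inner ℂ (ρ a (R x)) y = 0
  rw [← hint, hy _ (hM a x hx)]

theorem spaceKPC_le_spaceL (hHPC : spaceHPC R ≤ jointEigenspace π χ) :
    spaceKPC R ≤ spaceL π ρ R χ := by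
  refine Submodule.topologicalClosure_minimal _ ?_ isClosed_spaceL
  rintro _ ⟨x, rfl⟩
  exact map_mem_spaceL (hHPC (Submodule.le_topologicalClosure _ ⟨x, rfl⟩))

/-- Under minimality, an intertwining `R` has dense range. -/
theorem eq_zero_of_orthogonal_range (hint : ∀ a x, R (π a x) = ρ a (R x))
    (hmin : cyclicSpan ρ R ⊤ = ⊤) {y : K} (hy : ∀ x, inner ℂ (R x) y = 0) : y = 0 := by
  have hmem : y ∈ (cyclicSpan ρ R ⊤)ᗮ :=
    mem_orthogonal_cyclicSpan hint (fun _ _ _ => Submodule.mem_top) fun x _ => hy x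
  rw [hmin, Submodule.top_orthogonal_eq_bot] at hmem
  exact hmem

/-- Here `H_U ⊆ ker Δ_R`, where `R` preserves inner products with every vector, so `R x` stays
orthogonal to `R(M_χ(π))`. -/
theorem map_mem_spaceKU (hint : ∀ a x, R (π a x) = ρ a (R x))
    (hHPC : spaceHPC R ≤ jointEigenspace π χ) {x : H} (hx : x ∈ spaceHU π χ) :
    R x ∈ spaceKU π ρ R χ := by
  refine mem_orthogonal_cyclicSpan hint (reduces_of_le_jointEigenspace
    (isClosed_jointEigenspace π χ) le_rfl).map_mem fun m hm => ?_
  have hxI : x ∈ spaceHI R := spaceHI_eq_orthogonal R ▸ Submodule.orthogonal_le hHPC hx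
  rw [← inner_conj_symm, inner_map_of_mem_spaceHI hxI, inner_conj_symm, hx m hm]

theorem map_mem_spaceKS {x : H} (hx : x ∈ spaceHS π R χ) : R x ∈ spaceKS π ρ R χ :=
  ⟨map_mem_spaceKI R hx.1, map_mem_spaceL hx.2⟩

end Decomposition

end RDilation

/-! ### The decomposition theorem -/

open RDilation in
theorem corollary2p9 {A : Type*} [CStarAlgebra A]
    {H : Type*} [NormedAddCommGroup H] [InnerProductSpace ℂ H] [CompleteSpace H]
    [TopologicalSpace.SeparableSpace H]
    {K : Type*} [NormedAddCommGroup K] [InnerProductSpace ℂ K] [CompleteSpace K]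
    [TopologicalSpace.SeparableSpace K]
    (G : Set A) (hG : IsHyperrigid G)
    (χ : A →⋆ₐ[ℂ] ℂ) (hχ : ∀ g ∈ G, χ g = 0)
    (π : A →⋆ₐ[ℂ] (H →L[ℂ] H)) (ρ : A →⋆ₐ[ℂ] (K →L[ℂ] K))
    (R : H →L[ℂ] K) (hR : ‖R‖ ≤ 1)
    (hdil : ∀ g ∈ G, π g = ContinuousLinearMap.adjoint R ∘L ρ g ∘L R)
    (hmin : cyclicSpan ρ R ⊤ = ⊤) :
    -- `H = H_I ⊕ H_PC` and `H_I = H_U ⊕ H_S`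
    (IsOrthogonalSum ⊤ (spaceHI R) (spaceHPC R) ∧
      IsOrthogonalSum (spaceHI R) (spaceHU π χ) (spaceHS π R χ)) ∧
    -- `K = K_I ⊕ K_PC` and `K_I = K_U ⊕ K_S`
    (IsOrthogonalSum ⊤ (spaceKI R) (spaceKPC R) ∧
      IsOrthogonalSum (spaceKI R) (spaceKU π ρ R χ) (spaceKS π ρ R χ)) ∧
    -- `H_U, H_S, H_PC` reduce `π` and `K_U, K_S, K_PC` reduce `ρ`, which are scalar on `H_Uᗮ`, `K_Uᗮ`
    ∃ (hπU : Reduces π (spaceHU π χ)) (hρU : Reduces ρ (spaceKU π ρ R χ)),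
    (Reduces π (spaceHS π R χ) ∧ Reduces π (spaceHPC R) ∧
      ∀ a : A, ∀ x ∈ (spaceHU π χ)ᗮ, π a x = χ a • x) ∧
    (Reduces ρ (spaceKS π ρ R χ) ∧ Reduces ρ (spaceKPC R) ∧
      ∀ a : A, ∀ y ∈ (spaceKU π ρ R χ)ᗮ, ρ a y = χ a • y) ∧
    -- `R = R_I ⊕ R_PC` and `R_I = R_U ⊕ R_S`
    ∃ (RI : spaceHI R →L[ℂ] spaceKI R) (RPC : spaceHPC R →L[ℂ] spaceKPC R)
      (RU : spaceHU π χ →L[ℂ] spaceKU π ρ R χ) (RS : spaceHS π R χ →L[ℂ] spaceKS π ρ R χ),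
    (∀ (x : spaceHI R) (y : spaceHPC R), R ((x : H) + (y : H)) = (RI x : K) + (RPC y : K)) ∧
    (∀ (x : spaceHI R) (u : spaceHU π χ) (s : spaceHS π R χ),
      (x : H) = (u : H) + (s : H) → (RI x : K) = (RU u : K) + (RS s : K)) ∧
    -- `R_U` is unitary, `R_S` (and thus `R_I`) is isometric, `R_PC` is a pure contraction
    (IsUnitaryOperator RU ∧ Isometry RS ∧ IsPureContraction RPC ∧ Isometry RI) ∧
    -- `π(a)|H_U = R_U* ρ(a)|K_U R_U`
    (∀ a : A, (π a).restrict (hπU.map_mem a) =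
      ContinuousLinearMap.adjoint RU ∘L (ρ a).restrict (hρU.map_mem a) ∘L RU) ∧
    -- `D(R_I) = D(R_S) = ker R*`, the defect spaces being regarded as subspaces of `K`
    ((defectSpace RI).map (spaceKI R).subtype =
        LinearMap.ker (ContinuousLinearMap.adjoint R : K →ₗ[ℂ] H) ∧
      (defectSpace RS).map (spaceKS π ρ R χ).subtype =
        LinearMap.ker (ContinuousLinearMap.adjoint R : K →ₗ[ℂ] H)) := by
  have hall := hG.intertwines χ hχ π ρ R hR hdil
  have hint : ∀ a x, R (π a x) = ρ a (R x) := fun a x => (hall a x).1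
  have hHPC : spaceHPC R ≤ jointEigenspace π χ :=
    spaceHPC_le_jointEigenspace fun a x => (hall a x).2
  have hKPC : spaceKPC R ≤ spaceL π ρ R χ := spaceKPC_le_spaceL hHPC
  have hL : spaceL π ρ R χ ≤ jointEigenspace ρ χ := spaceL_le_jointEigenspace hint
  have hM := isClosed_jointEigenspace π χ
  have hHI := spaceHI_eq_orthogonal R
  have hHdec : IsOrthogonalSum ⊤ (spaceHI R) (spaceHPC R) :=
    hHI ▸ isOrthogonalSum_orthogonal (isClosed_spaceHPC R)
  have hHIdec : IsOrthogonalSum (spaceHI R) (spaceHU π χ) (spaceHS π R χ) := by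
    have := isOrthogonalSum_orthogonal_inf hM hHPC
    rwa [← hHI] at this
  have hKdec : IsOrthogonalSum ⊤ (spaceKI R) (spaceKPC R) :=
    isOrthogonalSum_orthogonal (isClosed_spaceKPC R)
  have hKIdec : IsOrthogonalSum (spaceKI R) (spaceKU π ρ R χ) (spaceKS π ρ R χ) :=
    isOrthogonalSum_orthogonal_inf isClosed_spaceL hKPC
  have hHU : spaceHU π χ ≤ spaceHI R := hHIdec.sup_eq ▸ le_sup_left
  have hπU : Reduces π (spaceHU π χ) := (reduces_of_le_jointEigenspace hM le_rfl).orthogonal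
  have hρU : Reduces ρ (spaceKU π ρ R χ) :=
    (reduces_of_le_jointEigenspace isClosed_spaceL hL).orthogonal
  have hRU : ∀ x ∈ spaceHU π χ, R x ∈ spaceKU π ρ R χ := fun x => map_mem_spaceKU hint hHPC
  have hRS : ∀ x ∈ spaceHS π R χ, R x ∈ spaceKS π ρ R χ := fun x => map_mem_spaceKS
  have hRI : ∀ x ∈ spaceHI R, R x ∈ spaceKI R := fun x => map_mem_spaceKI R
  have hRPC : ∀ x ∈ spaceHPC R, R x ∈ spaceKPC R := fun x => map_mem_spaceKPC R
  -- A vector orthogonal to the images of the three summands of `H` vanishes.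
  have hzero : ∀ y : K, (∀ x ∈ spaceHU π χ, inner ℂ (R x) y = 0) →
      (∀ x ∈ spaceHS π R χ, inner ℂ (R x) y = 0) →
      (∀ x ∈ spaceHPC R, inner ℂ (R x) y = 0) → y = 0 := fun y hU hS hPC => by
    refine eq_zero_of_orthogonal_range hint hmin fun x => ?_
    have hx : x ∈ spaceHI R ⊔ spaceHPC R := hHdec.sup_eq ▸ Submodule.mem_top
    rw [← hHIdec.sup_eq] at hx
    obtain ⟨v, hv, w, hw, rfl⟩ := Submodule.mem_sup.mp hx
    obtain ⟨u, hu, s, hs, rfl⟩ := Submodule.mem_sup.mp hv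
    rw [map_add, map_add, inner_add_left, inner_add_left, hU u hu, hS s hs, hPC w hw, add_zero,
      add_zero]
  -- A vector of `K_U` is orthogonal to `L_χ`, hence to the images of `H_S` and `H_PC`; if also
  -- orthogonal to `R(H_U)`, it vanishes.
  have hunit : IsUnitaryOperator (R.restrict hRU) := by
    refine isUnitaryOperator_of_isometry (isometry_restrict hHU hRU)
      ((Submodule.eq_bot_iff _).mpr fun y hy => Subtype.ext (hzero y (fun x hx => ?_)
        (fun x hx => y.2 _ (map_mem_spaceL hx.2)) fun x hx => y.2 _ (map_mem_spaceL (hHPC hx))))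
    exact hy (R.restrict hRU ⟨x, hx⟩) ⟨⟨x, hx⟩, rfl⟩
  -- Since `ker R*` is zero, the defect space identities reduce to the vanishing of both defect
  -- spaces.
  have hker : LinearMap.ker (ContinuousLinearMap.adjoint R : K →ₗ[ℂ] H) = ⊥ :=
    (Submodule.eq_bot_iff _).mpr fun y hy => eq_zero_of_orthogonal_range hint hmin fun x => by
      rw [← ContinuousLinearMap.adjoint_inner_right]
      exact (congrArg (inner ℂ x) hy).trans (inner_zero_right x)
  refine ⟨⟨hHdec, hHIdec⟩, ⟨hKdec, hKIdec⟩, hπU, hρU,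
    ⟨reduces_of_le_jointEigenspace hHIdec.isClosed_right inf_le_right,
      reduces_of_le_jointEigenspace (isClosed_spaceHPC R) hHPC, fun a x hx => ?_⟩,
    ⟨reduces_of_le_jointEigenspace hKIdec.isClosed_right (inf_le_right.trans hL),
      reduces_of_le_jointEigenspace (isClosed_spaceKPC R) (hKPC.trans hL), fun a y hy => ?_⟩,
    R.restrict hRI, R.restrict hRPC, R.restrict hRU, R.restrict hRS, fun x y => map_add R _ _,
    fun x u s hxus => (congrArg R hxus).trans (map_add R _ _),
    ⟨hunit, isometry_restrict inf_le_left hRS, isPureContraction_restrict hR hRPC,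
      isometry_restrict le_rfl hRI⟩, fun a => ?_, ?_, ?_⟩
  · rw [spaceHU, Submodule.orthogonal_orthogonal_eq_closure,
      hM.submodule_topologicalClosure_eq] at hx
    exact mem_jointEigenspace.mp hx a
  · rw [spaceKU, Submodule.orthogonal_orthogonal_eq_closure,
      isClosed_spaceL.submodule_topologicalClosure_eq] at hy
    exact mem_jointEigenspace.mp (hL hy) a
  · have hcomm : (ρ a).restrict (hρU.map_mem a) ∘L R.restrict hRU =
        R.restrict hRU ∘L (π a).restrict (hπU.map_mem a) := by
      ext x
      exact (hint a x).symm
    rw [hcomm, ← ContinuousLinearMap.comp_assoc, hunit.1, ContinuousLinearMap.id_comp]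
  · rw [hker, Submodule.eq_bot_iff]
    rintro _ ⟨y, hy, rfl⟩
    have hyI : ∀ x ∈ spaceHI R, inner ℂ (R x) (y : K) = 0 := fun x hx =>
      hy (R.restrict hRI ⟨x, hx⟩) ⟨⟨x, hx⟩, rfl⟩
    exact hzero y (fun x hx => hyI x (hHU hx)) (fun x hx => hyI x hx.1)
      fun x hx => y.2 _ (hRPC x hx)
  · rw [hker, Submodule.eq_bot_iff]
    rintro _ ⟨y, hy, rfl⟩
    exact hzero y (fun x hx => inner_eq_zero_symm.mp (hRU x hx y y.2.2))
      (fun x hx => hy (R.restrict hRS ⟨x, hx⟩) ⟨⟨x, hx⟩, rfl⟩) fun x hx => y.2.1 _ (hRPC x hx)
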